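/- Let $(\Omega,\mu)$ be a measure space, let $H=L^2(\Omega,\mu)$ (real-valued), and let $V$ be a real Hilbert space which is continuously and densely embedded in $H$. Let $T>0$ and let $\mathfrak a:[0,T]\times V\times V\to\mathbb R$ be such that $\mathfrak a(t,\cdot,\cdot)$ is bilinear for every $t\in[0,T]$, $\mathfrak a(\cdot,u,v)$ is measurable for all $u,v\in V$, and, for some constants $M\ge 0$, $\omega\in\mathbb R$, $\alpha>0$, $$|\mathfrak a(t,u,v)|\le M\|u\|_V\|v\|_V,\qquad \mathfrak a(t,u,u)+\omega\|u\|_H^2\ge\alpha\|u\|_V^2\qquad(t\in[0,T],\ u,v\in V).$$ Define $\mathcal A(t):V\to V'$ by $\langle\mathcal A(t)u,v\rangle=\mathfrak a(t,u,v)$. For $v\in H$ write $v^+=\max\{v,0\}$ and $v^-=(-v)^+$, and write $v\ge 0$ if $v(x)\ge0$ for $\mu$-a.e. $x$. Assume that $V$ is a sublattice of $H$, i.e. $v^+\in V$ for all $v\in V$, and that for a.e. $t\in[0,T]$ one has $\mathfrak a(t,v^+,v^-)\le 0$ for all $v\in V$. Let $u_0\in H$ with $u_0\ge 0$, and let $f\in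 L^2(0,T;V')$ be positive, i.e. for every $v\in V$ with $v\ge0$ one has $\langle f(t),v\rangle\ge 0$ for a.e. $t$. Let $u\in H^1(0,T;V')\cap L^2(0,T;V)$ be the solution of $$\dot u(t)+\mathcal A(t)u(t)=f(t)\ \text{ in } V' \text{ for a.e. } t\in(0,T),\qquad u(0)=u_0,$$ where $H$ is identified with a subspace of $V'$ by $h\mapsto(h\mid\cdot)_H$, $\dot u$ is the weak derivative, and $u$ denotes the representative in $C([0,T];H)$. Then $u(t)\ge 0$ for all $t\in[0,T]$. -/

import Mathlib

open MeasureTheory Set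
open scoped ContDiff

noncomputable section

namespace NonAutonomous

/-- Lebesgue measure on the time interval `(0, T)`. -/
abbrev timeMeasure (T : ℝ) : Measure ℝ := volume.restrict (Ioo 0 T)

/-- `u'` is the weak (distributional) derivative on `(0, T)` of the Banach-space-valued
function `u`: `∫₀ᵀ φ' u = - ∫₀ᵀ φ u'` for all test functions `φ ∈ C_c^∞(0, T)`. -/
def HasWeakDeriv {X : Type*} [NormedAddCommGroup X] [NormedSpace ℝ X]
    (T : ℝ) (u u' : ℝ → X) : Prop :=
  ∀ φ : ℝ → ℝ, ContDiff ℝ ∞ φ → HasCompactSupport φ → tsupport φ ⊆ Ioo 0 T →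
    ∫ t, deriv φ t • u t ∂(timeMeasure T) = - ∫ t, φ t • u' t ∂(timeMeasure T)

section Abstract

variable {V H : Type*} [NormedAddCommGroup V] [InnerProductSpace ℝ V]
  [NormedAddCommGroup H] [InnerProductSpace ℝ H]

/-- The embedding `H → V'`, `h ↦ (v ↦ (h | v)_H)`, attached to an embedding `j : V → H`. -/
def embDual (j : V →L[ℝ] H) (h : H) : StrongDual ℝ V := (innerSL ℝ h).comp j

/-- `𝔞 : [0, T] × V × V → ℝ` is a (real) non-autonomous closed form on `H`: bounded on `V`
uniformly in `t`, quasi-coercive uniformly in `t`, and measurable in `t`. Only the values of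
`𝔞 t` with `t ∈ [0, T]` matter. -/
def IsNonAutonomousClosedForm (j : V →L[ℝ] H) (T : ℝ) (𝔞 : ℝ → V →ₗ[ℝ] V →ₗ[ℝ] ℝ) : Prop :=
  (∃ M : ℝ, ∀ t ∈ Icc 0 T, ∀ u v : V, |𝔞 t u v| ≤ M * ‖u‖ * ‖v‖) ∧
  (∃ c α : ℝ, 0 < α ∧ ∀ t ∈ Icc 0 T, ∀ u : V, α * ‖u‖ ^ 2 ≤ 𝔞 t u u + c * ‖j u‖ ^ 2) ∧
  (∀ u v : V, AEMeasurable (fun t => 𝔞 t u v) (volume.restrict (Icc 0 T)))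

/-- `u : [0, T] → H` is the continuous representative of an element of
`MR(V, V') = H¹(0, T; V') ∩ L²(0, T; V)`. Here `w` is `u` regarded as an element of
`L²(0, T; V)`, and `u'` in `L²(0, T; V')` is the weak derivative of `u` regarded as a
`V'`-valued function. -/
structure IsMR (j : V →L[ℝ] H) (T : ℝ) (u : ℝ → H) (w : ℝ → V) (u' : ℝ → StrongDual ℝ V) :
    Prop where
  continuousOn : ContinuousOn u (Icc 0 T)
  memLp : MemLp w 2 (timeMeasure T)
  ae_eq : ∀ᵐ t ∂(timeMeasure T), j (w t) = u t
  memLp_deriv : MemLp u' 2 (timeMeasure T)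
  hasWeakDeriv : HasWeakDeriv T (fun t => embDual j (u t)) u'

/-- `u` (the continuous representative) is a solution in `MR(V, V')` of the Cauchy problem
`u'(t) + 𝒜(t) u(t) = f(t)` for a.e. `t`, `u(0) = u₀`, where `⟨𝒜(t) x, v⟩ = 𝔞(t, x, v)`. The
equation is an equality in `V'`. -/
def IsSolution (j : V →L[ℝ] H) (T : ℝ) (𝔞 : ℝ → V →ₗ[ℝ] V →ₗ[ℝ] ℝ)
    (f : ℝ → StrongDual ℝ V) (u₀ : H) (u : ℝ → H) : Prop :=
  u 0 = u₀ ∧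
  ∃ (w : ℝ → V) (u' : ℝ → StrongDual ℝ V), IsMR j T u w u' ∧
    ∀ᵐ t ∂(timeMeasure T), ∀ v : V, u' t v + 𝔞 t (w t) v = f t v

end Abstract

section Lattice

variable {Ω : Type*} [MeasurableSpace Ω] {μ : Measure Ω}
  {V : Type*} [NormedAddCommGroup V] [InnerProductSpace ℝ V]

/-- `V` (embedded by `j`) is a sublattice of `L²(Ω, μ)`: `v ∈ V` implies `v⁺ ∈ V`. -/
def IsSublattice (j : V →L[ℝ] Lp ℝ 2 μ) : Prop :=
  ∀ v : V, (j v)⁺ ∈ range j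

/-- A `V'`-valued function `f` on `(0, T)` is positive: for every `v ∈ V` with `v ≥ 0`,
`⟨f(t), v⟩ ≥ 0` for a.e. `t`. -/
def IsPositive (j : V →L[ℝ] Lp ℝ 2 μ) (T : ℝ) (f : ℝ → StrongDual ℝ V) : Prop :=
  ∀ v : V, 0 ≤ j v → ∀ᵐ t ∂(timeMeasure T), 0 ≤ f t v

end Lattice

end NonAutonomous

end

open Filter Topology

noncomputable section

namespace NonAutonomous

/-! Formally, testing the equation with `u⁻` gives `d/dt ‖u⁻‖² ≤ 2|c| ‖u⁻‖²`, and Grönwall forces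
`u⁻ = 0`. The chain rule for `‖u⁻‖²` is bypassed by convexity: `norm_negPart_sq_sub_le` bounds the
increment from `r` to `s` by `-2 (u(s) - u(r) | u(s)⁻) = -2 ∫_r^s ⟨u'(x), n⟩ dx`, where `n = u(s)⁻ ∈
V` is frozen.

Put `g = f - u'`, which is `𝒜u` a.e. Since `⟨f(x), n⟩ ≥ 0`, the integrand is at most `2⟨g(s), n⟩ +
2‖n‖ ‖g(x) - g(s)‖`. By `norm_le_of_negPart`, `⟨g(s), n⟩ ≤ |c| ‖u(s)⁻‖²` and `‖n‖` is at most a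
multiple of `‖w(s)‖`. Taking `r = s - h`, integrating in `s` and dividing by `h` makes the error
vanish as `h → 0`, because `g` is in `L²` (`le_add_mul_integral_of_forall_sub_le`). Freezing `n`
avoids any measurability question for `s ↦ u(s)⁻` in `V`. -/

/-! ### Mollified indicators and the fundamental theorem of calculus for weak derivatives. -/

/-- The convolution of the indicator function of `[x, y]` with a normalized bump function. -/
def mollifiedIndicator (ρ : ContDiffBump (0 : ℝ)) (x y t : ℝ) : ℝ :=
  ∫ s in (x - t)..(y - t), ρ.normed volume s

theorem hasDerivAt_mollifiedIndicator (ρ : ContDiffBump (0 : ℝ)) (x y t : ℝ) :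
    HasDerivAt (mollifiedIndicator ρ x y)
      (ρ.normed volume (x - t) - ρ.normed volume (y - t)) t := by
  have hc : Continuous (ρ.normed volume) := ρ.continuous_normed
  have key : ∀ z : ℝ, HasDerivAt (fun t => ∫ s in (0 : ℝ)..(z - t), ρ.normed volume s)
      (-ρ.normed volume (z - t)) t := fun z => by
    have h1 := intervalIntegral.integral_hasDerivAt_right (hc.intervalIntegrable 0 (z - t))
      (hc.stronglyMeasurableAtFilter _ _) hc.continuousAt
    exact (HasDerivAt.scomp t h1 ((hasDerivAt_id t).const_sub z)).congr_deriv (by simp)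
  have h := (key y).sub (key x)
  have e : mollifiedIndicator ρ x y = (fun t => ∫ s in (0 : ℝ)..(y - t), ρ.normed volume s) -
      fun t => ∫ s in (0 : ℝ)..(x - t), ρ.normed volume s := by
    funext t
    exact (intervalIntegral.integral_interval_sub_left (hc.intervalIntegrable _ _)
      (hc.intervalIntegrable _ _)).symm
  rw [e]
  exact h.congr_deriv (by ring)

theorem contDiff_mollifiedIndicator (ρ : ContDiffBump (0 : ℝ)) (x y : ℝ) :
    ContDiff ℝ ∞ (mollifiedIndicator ρ x y) := by
  refine contDiff_infty_iff_deriv.2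
    ⟨fun t => (hasDerivAt_mollifiedIndicator ρ x y t).differentiableAt, ?_⟩
  have hc : ContDiff ℝ ∞ (ρ.normed volume) := ρ.contDiff_normed
  rw [funext fun t => (hasDerivAt_mollifiedIndicator ρ x y t).deriv]
  fun_prop

theorem mollifiedIndicator_nonneg (ρ : ContDiffBump (0 : ℝ)) {x y : ℝ} (hxy : x ≤ y) (t : ℝ) :
    0 ≤ mollifiedIndicator ρ x y t :=
  intervalIntegral.integral_nonneg (by linarith) fun s _ => ρ.nonneg_normed s

theorem mollifiedIndicator_le_one (ρ : ContDiffBump (0 : ℝ)) {x y : ℝ} (hxy : x ≤ y) (t : ℝ) :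
    mollifiedIndicator ρ x y t ≤ 1 := by
  rw [mollifiedIndicator, intervalIntegral.integral_of_le (by linarith),
    ← ρ.integral_normed (μ := volume)]
  exact setIntegral_le_integral ρ.integrable_normed (Eventually.of_forall fun s => ρ.nonneg_normed s)

theorem normed_eq_zero (ρ : ContDiffBump (0 : ℝ)) {s : ℝ} (hs : ρ.rOut ≤ |s|) :
    ρ.normed volume s = 0 := by
  refine Function.notMem_support.1 fun h => ?_
  rw [ρ.support_normed_eq, Metric.mem_ball, Real.dist_eq, sub_zero] at h
  exact absurd h (not_lt.2 hs)

theorem mollifiedIndicator_eq_zero (ρ : ContDiffBump (0 : ℝ)) {x y t : ℝ} (hxy : x ≤ y)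
    (ht : t ∉ Icc (x - ρ.rOut) (y + ρ.rOut)) : mollifiedIndicator ρ x y t = 0 := by
  have : ∀ s ∈ uIcc (x - t) (y - t), ρ.normed volume s = 0 := fun s hs => by
    rw [uIcc_of_le (by linarith)] at hs
    refine normed_eq_zero ρ (le_abs.2 ?_)
    by_contra! h
    exact ht ⟨by linarith [hs.1, hs.2], by linarith [hs.1, hs.2]⟩
  rw [mollifiedIndicator, intervalIntegral.integral_congr this, intervalIntegral.integral_zero]

theorem mollifiedIndicator_eq_one (ρ : ContDiffBump (0 : ℝ)) {x y t : ℝ}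
    (hx : x + ρ.rOut ≤ t) (hy : t ≤ y - ρ.rOut) : mollifiedIndicator ρ x y t = 1 := by
  have hr := ρ.rOut_pos
  rw [mollifiedIndicator, intervalIntegral.integral_of_le (by linarith),
    ← ρ.integral_normed (μ := volume)]
  refine setIntegral_eq_integral_of_forall_compl_eq_zero fun s hs => normed_eq_zero ρ (le_abs.2 ?_)
  by_contra! h
  exact hs ⟨by linarith, by linarith⟩

/-- A continuous function whose weak derivative is integrable satisfies the fundamental theorem of
calculus. -/
theorem HasWeakDeriv.integral_eq_sub {X : Type*} [NormedAddCommGroup X] [NormedSpace ℝ X]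
    [CompleteSpace X] {T : ℝ} {F F' : ℝ → X} (hF : ContinuousOn F (Icc 0 T))
    (hF' : Integrable F' (timeMeasure T)) (h : HasWeakDeriv T F F') {a b : ℝ} (ha : 0 < a)
    (hab : a < b) (hb : b < T) : ∫ t in a..b, F' t = F b - F a := by
  have hT : 0 ≤ T := by linarith
  let ρ : ℕ → ContDiffBump (0 : ℝ) := fun n =>
    ⟨1 / ((n : ℝ) + 1) / 2, 1 / ((n : ℝ) + 1), by positivity, half_lt_self (by positivity)⟩
  have hρ : Tendsto (fun n => (ρ n).rOut) atTop (𝓝 0) := tendsto_one_div_add_atTop_nhds_zero_nat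
  let G : ℝ → X := IccExtend hT ((Icc 0 T).domRestrict F)
  have hG : Continuous G := hF.domRestrict.Icc_extend'
  have hGF : ∀ t ∈ Icc 0 T, G t = F t := fun t ht => IccExtend_of_mem hT _ ht
  -- The derivative of the test function is a bump at `a` minus a bump at `b`, so these are
  -- convolutions evaluated at `a` and `b`.
  have lim1 : Tendsto (fun n => ∫ t, deriv (mollifiedIndicator (ρ n) a b) t • G t) atTop
      (𝓝 (G a - G b)) := by
    have hlim := fun x₀ => ContDiffBump.convolution_tendsto_right_of_continuous (μ := volume)
      hρ hG x₀
    refine ((hlim a).sub (hlim b)).congr fun n => ?_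
    have hint : ∀ z, Integrable (fun t => (ρ n).normed volume (z - t) • G t) := fun z => by
      refine Continuous.integrable_of_hasCompactSupport
        (((ρ n).continuous_normed.comp (continuous_const.sub continuous_id)).smul hG) ?_
      exact HasCompactSupport.smul_right
        ((ρ n).hasCompactSupport_normed.comp_homeomorph (Homeomorph.subLeft z))
    rw [convolution_lsmul_swap, convolution_lsmul_swap, ← integral_sub (hint a) (hint b)]
    refine integral_congr_ae (Eventually.of_forall fun t => ?_)
    simp only [(hasDerivAt_mollifiedIndicator (ρ n) a b t).deriv, sub_smul]
  -- Here `0 < a` and `b < T` leave room for the test function to be supported in `(0, T)`.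
  have hsmall : ∀ᶠ n in atTop, (ρ n).rOut < min a (T - b) :=
    hρ.eventually_lt_const (lt_min ha (by linarith))
  have lim2 : Tendsto (fun n => ∫ t, mollifiedIndicator (ρ n) a b t • F' t ∂(timeMeasure T)) atTop
      (𝓝 (∫ t, (Ioo a b).indicator F' t ∂(timeMeasure T))) := by
    refine tendsto_integral_of_dominated_convergence (fun t => ‖F' t‖)
      (fun n => ?_) hF'.norm (fun n => ?_) ?_
    · exact (contDiff_mollifiedIndicator (ρ n) a b).continuous.aestronglyMeasurable.smul
        hF'.aestronglyMeasurable
    · refine Eventually.of_forall fun t => ?_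
      rw [norm_smul, Real.norm_of_nonneg (mollifiedIndicator_nonneg _ hab.le _)]
      exact mul_le_of_le_one_left (norm_nonneg _) (mollifiedIndicator_le_one _ hab.le _)
    · have hne : ∀ z : ℝ, ∀ᵐ t ∂(timeMeasure T), t ≠ z := fun z =>
        ae_restrict_of_ae (Measure.ae_ne volume z)
      filter_upwards [hne a, hne b] with t hta htb
      refine tendsto_const_nhds.congr' ?_
      by_cases ht : t ∈ Ioo a b
      · filter_upwards [hρ.eventually_lt_const (lt_min (sub_pos.2 ht.1) (sub_pos.2 ht.2))] with n hn
        rw [lt_min_iff] at hn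
        rw [mollifiedIndicator_eq_one _ (by linarith) (by linarith), one_smul,
          indicator_of_mem ht]
      · have : 0 < max (a - t) (t - b) := by
          by_contra! hc
          rw [max_le_iff] at hc
          exact ht ⟨lt_of_le_of_ne (by linarith) (Ne.symm hta), lt_of_le_of_ne (by linarith) htb⟩
        filter_upwards [hρ.eventually_lt_const this] with n hn
        rw [mollifiedIndicator_eq_zero _ hab.le, zero_smul, indicator_of_notMem ht]
        rintro ⟨h1, h2⟩
        rcases lt_max_iff.1 hn with h | h <;> linarith
  have heq : (fun n => -∫ t, deriv (mollifiedIndicator (ρ n) a b) t • G t) =ᶠ[atTop]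
      fun n => ∫ t, mollifiedIndicator (ρ n) a b t • F' t ∂(timeMeasure T) := by
    filter_upwards [hsmall] with n hn
    rw [lt_min_iff] at hn
    have hsupp : tsupport (mollifiedIndicator (ρ n) a b) ⊆
        Icc (a - (ρ n).rOut) (b + (ρ n).rOut) := by
      refine closure_minimal (fun t ht => ?_) isClosed_Icc
      by_contra hc
      exact ht (mollifiedIndicator_eq_zero _ hab.le hc)
    have hsub : Icc (a - (ρ n).rOut) (b + (ρ n).rOut) ⊆ Ioo 0 T := fun t ht =>
      ⟨by linarith [ht.1], by linarith [ht.2]⟩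
    have hw := h _ (contDiff_mollifiedIndicator (ρ n) a b)
      (HasCompactSupport.of_support_subset_isCompact isCompact_Icc (subset_closure.trans hsupp))
      (hsupp.trans hsub)
    rw [neg_eq_iff_eq_neg, ← hw]
    rw [← setIntegral_eq_integral_of_forall_compl_eq_zero (s := Ioo 0 T)]
    · refine setIntegral_congr_fun measurableSet_Ioo fun t ht => ?_
      simp only [hGF t (Ioo_subset_Icc_self ht)]
    · intro t ht
      have : t ∉ Function.support (deriv (mollifiedIndicator (ρ n) a b)) := fun hc =>
        ht (hsub (hsupp (support_deriv_subset hc)))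
      rw [Function.notMem_support.1 this, zero_smul]
  have huniq := tendsto_nhds_unique (lim1.neg.congr' heq) lim2
  rw [neg_sub, hGF a ⟨ha.le, by linarith⟩, hGF b ⟨by linarith, hb.le⟩] at huniq
  rw [huniq, integral_indicator measurableSet_Ioo, Measure.restrict_restrict measurableSet_Ioo,
    inter_eq_left.2 (Ioo_subset_Ioo ha.le hb.le), intervalIntegral.integral_of_le hab.le,
    integral_Ioc_eq_integral_Ioo]

/-! ### Negative parts in `L²` and in the form domain. -/

section Lattice

variable {Ω : Type*} [MeasurableSpace Ω] {μ : Measure Ω}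

theorem coeFn_posPart (a : Lp ℝ 2 μ) : ⇑(a⁺) =ᵐ[μ] fun x => max (a x) 0 := by
  filter_upwards [Lp.coeFn_sup a 0, Lp.coeFn_zero ℝ 2 μ] with x h1 h2
  rw [posPart_def, h1, Pi.sup_apply, h2, Pi.zero_apply]

theorem coeFn_negPart (a : Lp ℝ 2 μ) : ⇑(a⁻) =ᵐ[μ] fun x => max (-a x) 0 := by
  rw [← posPart_neg]
  filter_upwards [coeFn_posPart (-a), Lp.coeFn_neg a] with x h1 h2
  rw [h1, h2, Pi.neg_apply]

theorem inner_posPart_negPart (a : Lp ℝ 2 μ) : inner ℝ a⁺ a⁻ = 0 := by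
  rw [L2.inner_def]
  refine integral_eq_zero_of_ae ?_
  filter_upwards [coeFn_posPart a, coeFn_negPart a] with x h1 h2
  rw [h1, h2]
  rcases le_total 0 (a x) with h | h <;> simp [h]

theorem inner_nonneg_of_nonneg {a b : Lp ℝ 2 μ} (ha : 0 ≤ a) (hb : 0 ≤ b) :
    0 ≤ inner ℝ a b := by
  rw [L2.inner_def]
  refine integral_nonneg_of_ae ?_
  filter_upwards [(Lp.coeFn_nonneg a).2 ha, (Lp.coeFn_nonneg b).2 hb] with x h1 h2
  simpa using mul_nonneg h2 h1

theorem inner_self_negPart (a : Lp ℝ 2 μ) : inner ℝ a a⁻ = -‖a⁻‖ ^ 2 := by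
  conv_lhs => rw [← posPart_sub_negPart a]
  rw [inner_sub_left, posPart_sub_negPart, inner_posPart_negPart,
    real_inner_self_eq_norm_sq, zero_sub]

/-- Convexity of `a ↦ ‖a⁻‖² / 2`, whose gradient is `-a⁻`. -/
theorem norm_negPart_sq_sub_le (a b : Lp ℝ 2 μ) :
    ‖a⁻‖ ^ 2 - ‖b⁻‖ ^ 2 ≤ -(2 * inner ℝ (a - b) a⁻) := by
  have h2 : -(‖a⁻‖ * ‖b⁻‖) ≤ inner ℝ b a⁻ := by
    conv_rhs => rw [← posPart_sub_negPart b]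
    rw [inner_sub_left]
    have := inner_nonneg_of_nonneg (posPart_nonneg b) (negPart_nonneg a)
    have := real_inner_le_norm b⁻ a⁻
    linarith
  rw [inner_sub_left, inner_self_negPart]
  nlinarith [sq_nonneg (‖a⁻‖ - ‖b⁻‖)]

theorem norm_negPart_le (a : Lp ℝ 2 μ) : ‖a⁻‖ ≤ ‖a‖ := by
  have h := inner_self_negPart a
  have := abs_real_inner_le_norm a a⁻
  have := neg_le_abs (inner ℝ a a⁻)
  by_contra! hc
  nlinarith [norm_nonneg a, norm_nonneg a⁻]

theorem continuous_negPart : Continuous fun a : Lp ℝ 2 μ => a⁻ := by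
  refine Lp.continuous_negPart.congr fun a => Lp.ext ?_
  filter_upwards [Lp.coeFn_negPart_eq_max a, coeFn_negPart a] with x h1 h2
  rw [h1, h2]

variable {V : Type*} [NormedAddCommGroup V] [InnerProductSpace ℝ V]

/-- The negative part of an element of `V` is controlled in `V`. -/
theorem norm_le_of_negPart {j : V →L[ℝ] Lp ℝ 2 μ} (hj : Function.Injective j)
    {a : V →ₗ[ℝ] V →ₗ[ℝ] ℝ} {M c α : ℝ} (hα : 0 < α)
    (hM : ∀ u v : V, |a u v| ≤ M * ‖u‖ * ‖v‖) (hc : ∀ u : V, α * ‖u‖ ^ 2 ≤ a u u + c * ‖j u‖ ^ 2)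
    (ha : ∀ v p n : V, j p = (j v)⁺ → j n = (j v)⁻ → a p n ≤ 0) {v p n : V}
    (hp : j p = (j v)⁺) (hn : j n = (j v)⁻) :
    ‖n‖ ≤ (M + |c| * ‖j‖ ^ 2) / α * ‖v‖ ∧ a v n ≤ |c| * ‖(j v)⁻‖ ^ 2 := by
  have hv : v = p - n := hj (by rw [map_sub, hp, hn, posPart_sub_negPart])
  have h1 : a v n = a p n - a n n := by
    conv_lhs => rw [hv]
    -- Since `a p n ≤ 0`, coercivity at `n` gives `α‖n‖² ≤ -a v n + |c| ‖j n‖²`; both conclusions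
    -- come from this.
    rw [map_sub, LinearMap.sub_apply]
  have h2 := ha v p n hp hn
  have h3 := hc n
  have h4 : c * ‖j n‖ ^ 2 ≤ |c| * ‖j n‖ ^ 2 := by gcongr; exact le_abs_self c
  have h5 : ‖j n‖ ≤ ‖j‖ * ‖v‖ := by
    rw [hn]
    exact (norm_negPart_le _).trans (j.le_opNorm v)
  have h6 : ‖j n‖ ^ 2 ≤ ‖j‖ ^ 2 * ‖v‖ * ‖n‖ :=
    calc ‖j n‖ ^ 2 = ‖j n‖ * ‖j n‖ := sq _
      _ ≤ (‖j‖ * ‖v‖) * (‖j‖ * ‖n‖) := by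
          gcongr
          exact j.le_opNorm n
      _ = ‖j‖ ^ 2 * ‖v‖ * ‖n‖ := by ring
  have h7 : -a v n ≤ M * ‖v‖ * ‖n‖ := (neg_le_abs _).trans (hM v n)
  constructor
  · have h8 : |c| * ‖j n‖ ^ 2 ≤ |c| * (‖j‖ ^ 2 * ‖v‖ * ‖n‖) := by gcongr
    have h9 : ‖n‖ * (α * ‖n‖) ≤ ‖n‖ * ((M + |c| * ‖j‖ ^ 2) * ‖v‖) := by nlinarith
    rw [div_mul_eq_mul_div, le_div_iff₀ hα]
    -- If `n = 0` nothing can be cancelled. No sign of `M` is assumed, so it is read off from the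
    -- bound on `a v v`.
    rcases (norm_nonneg n).eq_or_lt with h0 | h0
    · have hM0 : 0 ≤ M * ‖v‖ * ‖v‖ := (abs_nonneg _).trans (hM v v)
      rw [← h0, zero_mul, add_mul]
      refine add_nonneg ?_ (by positivity)
      rcases (norm_nonneg v).eq_or_lt with hv0 | hv0
      · simp [← hv0]
      · exact nonneg_of_mul_nonneg_left hM0 hv0
    · rw [mul_comm]
      exact le_of_mul_le_mul_left h9 h0
  · rw [← hn]
    nlinarith [mul_nonneg hα.le (sq_nonneg ‖n‖)]

end Lattice

/-! ### Grönwall and the passage from increments to an integral inequality. -/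

/-- A special case of the Grönwall inequality. -/
theorem nonpos_of_le_mul_integral {y : ℝ → ℝ} (hy : Continuous y) {K T : ℝ} (hK : 0 ≤ K)
    (h : ∀ t ∈ Ioc 0 T, y t ≤ K * ∫ s in (0 : ℝ)..t, y s) : ∀ t ∈ Ioc 0 T, y t ≤ 0 := by
  have hY : ∀ t, HasDerivAt (fun t => ∫ s in (0 : ℝ)..t, y s) (y t) t := fun t =>
    intervalIntegral.integral_hasDerivAt_right (hy.intervalIntegrable _ _)
      (hy.stronglyMeasurableAtFilter _ _) hy.continuousAt
  let Z : ℝ → ℝ := fun t => Real.exp (-K * t) * ∫ s in (0 : ℝ)..t, y s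
  have hZ : ∀ t, HasDerivAt Z
      (Real.exp (-K * t) * (y t - K * ∫ s in (0 : ℝ)..t, y s)) t := fun t => by
    have h1 : HasDerivAt (fun t => Real.exp (-K * t)) (Real.exp (-K * t) * -K) t := by
      simpa using ((hasDerivAt_id t).const_mul (-K)).exp
    exact (h1.mul (hY t)).congr_deriv (by ring)
  have hanti : AntitoneOn Z (Icc 0 T) := by
    refine antitoneOn_of_deriv_nonpos (convex_Icc 0 T)
      (fun t _ => (hZ t).continuousAt.continuousWithinAt)
      (fun t _ => (hZ t).differentiableAt.differentiableWithinAt) fun t ht => ?_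
    rw [interior_Icc] at ht
    rw [(hZ t).deriv]
    exact mul_nonpos_of_nonneg_of_nonpos (Real.exp_pos _).le
      (by linarith [h t (Ioo_subset_Ioc_self ht)])
  intro t ht
  have h1 : Z t ≤ Z 0 :=
    hanti ⟨le_rfl, ht.1.le.trans ht.2⟩ (Ioc_subset_Icc_self ht) ht.1.le
  have h2 : Z 0 = 0 := by simp [Z]
  have h3 : ∫ s in (0 : ℝ)..t, y s ≤ 0 :=
    nonpos_of_mul_nonpos_right (h1.trans h2.le) (Real.exp_pos _)
  exact (h t ht).trans (mul_nonpos_of_nonneg_of_nonpos hK h3)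

theorem integral_sub_comp_sub {f : ℝ → ℝ} (hf : Continuous f) (h t : ℝ) :
    ∫ s in h..t, (f s - f (s - h)) = (∫ s in (t - h)..t, f s) - ∫ s in (0 : ℝ)..h, f s := by
  have hi : ∀ a b, IntervalIntegrable f volume a b := fun a b => hf.intervalIntegrable a b
  have hs : IntervalIntegrable (fun s => f (s - h)) volume h t :=
    Continuous.intervalIntegrable (by fun_prop) _ _
  rw [intervalIntegral.integral_sub (hi _ _) hs,
    intervalIntegral.integral_comp_sub_right, sub_self,
    ← intervalIntegral.integral_interval_sub_left (hi 0 t) (hi 0 h),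
    ← intervalIntegral.integral_interval_sub_left (hi 0 t) (hi 0 (t - h))]
  ring

/-- The integral telescopes to `∫_{t-h}^t y - ∫_0^h y`, whose right derivative at `h = 0` is `y t -
y 0`; divide by `h` and let `h → 0⁺`. -/
theorem sub_le_of_integral_sub_le {y : ℝ → ℝ} (hy : Continuous y) {t R : ℝ}
    (h : ∀ᶠ h in 𝓝[>] 0, ∫ s in h..t, (y s - y (s - h)) ≤ h * R) : y t - y 0 ≤ R := by
  have hY : ∀ t, HasDerivAt (fun t => ∫ s in (0 : ℝ)..t, y s) (y t) t := fun t =>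
    intervalIntegral.integral_hasDerivAt_right (hy.intervalIntegrable _ _)
      (hy.stronglyMeasurableAtFilter _ _) hy.continuousAt
  have hZ : HasDerivAt (fun x => (∫ s in (0 : ℝ)..t, y s) - (∫ s in (0 : ℝ)..(t - x), y s) -
      ∫ s in (0 : ℝ)..x, y s) (y t - y 0) 0 := by
    have h1 : HasDerivAt (fun x => ∫ s in (0 : ℝ)..(t - x), y s) (-y t) 0 := by
      have h2 : HasDerivAt (fun t => ∫ s in (0 : ℝ)..t, y s) (y t) (t - 0) := by
        simpa using hY t
      exact (HasDerivAt.scomp 0 h2 ((hasDerivAt_id 0).const_sub t)).congr_deriv (by simp)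
    exact ((h1.const_sub _).sub (hY 0)).congr_deriv (by ring)
  have hsub : Ioi (0 : ℝ) ⊆ {0}ᶜ := fun x hx => (mem_Ioi.1 hx).ne'
  have hlim := hZ.tendsto_slope.mono_left (nhdsWithin_mono (0 : ℝ) hsub)
  refine le_of_tendsto hlim ?_
  filter_upwards [h, self_mem_nhdsWithin] with x hx hx0
  have hx0 : 0 < x := hx0
  rw [integral_sub_comp_sub hy, ← intervalIntegral.integral_interval_sub_left
    (hy.intervalIntegrable 0 t) (hy.intervalIntegrable 0 (t - x))] at hx
  rw [slope_def_field, div_le_iff₀ (by simpa using hx0)]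
  simpa [mul_comm] using hx

theorem mul_le_half_sq_add {ε : ℝ} (hε : 0 < ε) (x z : ℝ) :
    x * z ≤ ε / 2 * x ^ 2 + z ^ 2 / (2 * ε) := by
  have : ε / 2 * x ^ 2 + z ^ 2 / (2 * ε) - x * z = (ε * x - z) ^ 2 / (2 * ε) := by
    field_simp
    ring
  have : 0 ≤ (ε * x - z) ^ 2 / (2 * ε) := by positivity
  linarith

/-- An `L²` function is only continuous on average, so the hypothesis is used with `r = s - h` and
integrated over `s`. Replacing `g` by a uniformly continuous `L²`-approximation `g₁` and applying
Young's inequality leaves an error `O(ε) h`. -/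
theorem le_add_mul_integral_of_forall_sub_le {E : Type*} [NormedAddCommGroup E] [NormedSpace ℝ E]
    {T K C : ℝ} {y W : ℝ → ℝ} {g : ℝ → E} (hy : Continuous y) (hy0 : ∀ s, 0 ≤ y s) (hK : 0 ≤ K)
    (hW : MemLp W 2 (timeMeasure T)) (hg : MemLp g 2 (timeMeasure T))
    (h : ∀ᵐ s ∂(timeMeasure T), ∀ r ∈ Ioo 0 s,
      y s - y r ≤ ∫ x in r..s, (K * y s + C * W s * ‖g x - g s‖))
    {t : ℝ} (ht : t ∈ Ioc 0 T) : y t ≤ y 0 + K * ∫ s in (0 : ℝ)..t, y s := by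
  -- The three Young inequalities give the first term, the oscillation of `g₁` gives `t / 2`, and
  -- the approximation error at `s` and at `x` gives `1 / 2` each.
  set D : ℝ := 3 / 2 * C ^ 2 * (∫ s, W s ^ 2 ∂(timeMeasure T)) + t / 2 + 1 with hD
  suffices hmain : ∀ ε : ℝ, 0 < ε → y t - y 0 ≤ K * (∫ s in (0 : ℝ)..t, y s) + ε * D by
    have hlim : Tendsto (fun ε : ℝ => K * (∫ s in (0 : ℝ)..t, y s) + ε * D) (𝓝[>] 0)
        (𝓝 (K * (∫ s in (0 : ℝ)..t, y s) + 0 * D)) :=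
      Tendsto.mono_left (Continuous.tendsto (by fun_prop) 0) nhdsWithin_le_nhds
    have := ge_of_tendsto hlim (eventually_nhdsWithin_of_forall fun ε hε => hmain ε hε)
    linarith
  intro ε hε
  -- Accuracy `ε ^ 2` compensates the weight `1 / (2 * ε)` from Young's inequality.
  obtain ⟨g₁, hg₁s, hg₁, hg₁c, hg₁m⟩ :=
    MemLp.exists_hasCompactSupport_integral_rpow_sub_le (p := 2) (μ := timeMeasure T)
      two_pos (f := g) (by simpa using hg) (ε := ε ^ 2) (by positivity)
  have hgg : MemLp (g - g₁) 2 (timeMeasure T) := hg.sub (by simpa using hg₁m)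
  let q : ℝ → ℝ := (Ioo 0 T).indicator fun s => ‖g s - g₁ s‖ ^ 2
  have hq0 : ∀ s, 0 ≤ q s := fun s => indicator_nonneg (fun s _ => by positivity) s
  have hqi : Integrable q :=
    (integrable_indicator_iff measurableSet_Ioo).2 (hgg.integrable_norm_pow (by norm_num))
  have hqle : ∫ s, q s ≤ ε ^ 2 := by
    rw [integral_indicator measurableSet_Ioo]
    simpa using hg₁
  let Q : ℝ → ℝ := fun x => ∫ s in (0 : ℝ)..x, q s
  have hQc : Continuous Q := intervalIntegral.continuous_primitive (fun _ _ => hqi.intervalIntegrable) 0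
  have hQ0 : ∀ x, 0 ≤ x → 0 ≤ Q x := fun x hx => intervalIntegral.integral_nonneg hx fun s _ => hq0 s
  have hQle : ∀ x, 0 ≤ x → Q x ≤ ε ^ 2 := fun x hx => by
    refine le_trans ?_ hqle
    rw [show Q x = ∫ s in Ioc 0 x, q s from intervalIntegral.integral_of_le hx]
    exact setIntegral_le_integral hqi (Eventually.of_forall hq0)
  obtain ⟨δ, hδ, hg₁u⟩ := Metric.uniformContinuous_iff.1
    (hg₁s.uniformContinuous_of_continuous hg₁c) ε hε
  refine sub_le_of_integral_sub_le hy ?_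
  filter_upwards [Ioo_mem_nhdsGT (lt_min hδ ht.1)] with r hr
  obtain ⟨hr0, hr1⟩ := hr
  rw [lt_min_iff] at hr1
  -- The part of the bound that is constant in `x`; only `q x / (2 * ε)` remains under the inner
  -- integral.
  let B : ℝ → ℝ := fun s => K * y s + 3 / 2 * ε * C ^ 2 * W s ^ 2 + ε / 2 + q s / (2 * ε)
  have hsub : Ioc r t ⊆ Ioc 0 T := Ioc_subset_Ioc hr0.le ht.2
  have hWi : IntegrableOn (fun s => W s ^ 2) (Ioc 0 T) := by
    rw [integrableOn_Ioc_iff_integrableOn_Ioo]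
    exact hW.integrable_sq
  have hWi' : IntervalIntegrable (fun s => 3 / 2 * ε * C ^ 2 * W s ^ 2) volume r t :=
    ((intervalIntegrable_iff_integrableOn_Ioc_of_le hr1.2.le).2 (hWi.mono_set hsub)).const_mul _
  have hyi : IntervalIntegrable (fun s => K * y s) volume r t :=
    (hy.intervalIntegrable r t).const_mul K
  have hqi' : IntervalIntegrable (fun s => q s / (2 * ε)) volume r t :=
    hqi.intervalIntegrable.div_const _
  have hBi : IntervalIntegrable B volume r t :=
    ((hyi.add hWi').add intervalIntegrable_const).add hqi'
  have hQi : IntervalIntegrable (fun s => (Q s - Q (s - r)) / (2 * ε)) volume r t :=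
    Continuous.intervalIntegrable (by fun_prop) _ _
  have hpt : ∀ᵐ s ∂(volume.restrict (Ioc r t)),
      y s - y (s - r) ≤ r * B s + (Q s - Q (s - r)) / (2 * ε) := by
    have hae : ∀ᵐ s ∂(volume.restrict (Ioc 0 T)), s ∈ Ioo 0 T ∧ ∀ r ∈ Ioo 0 s,
        y s - y r ≤ ∫ x in r..s, (K * y s + C * W s * ‖g x - g s‖) := by
      rw [← restrict_Ioo_eq_restrict_Ioc]
      exact (ae_restrict_mem measurableSet_Ioo).and h
    filter_upwards [ae_restrict_of_ae_restrict_of_subset hsub hae,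
      ae_restrict_mem measurableSet_Ioc] with s hs hsr
    obtain ⟨hsT, hs⟩ := hs
    have hrs : r < s := hsr.1
    have hlt : s - r ≤ s := by linarith
    refine (hs (s - r) ⟨by linarith, by linarith⟩).trans ?_
    have hsub' : Icc (s - r) s ⊆ Ioo 0 T := fun x hx => ⟨by linarith [hx.1], hx.2.trans_lt hsT.2⟩
    have hgi : IntervalIntegrable (fun x => ‖g x - g s‖) volume (s - r) s := by
      rw [intervalIntegrable_iff_integrableOn_Ioc_of_le hlt]
      have : IntegrableOn (fun x => ‖g x - g s‖) (Ioo 0 T) :=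
        ((hg.integrable one_le_two).sub (integrable_const _)).norm
      exact this.mono_set (Ioc_subset_Icc_self.trans hsub')
    have hb : ∫ x in (s - r)..s, (K * y s + C * W s * ‖g x - g s‖) ≤
        ∫ x in (s - r)..s, (B s + q x / (2 * ε)) := by
      refine intervalIntegral.integral_mono_on hlt (intervalIntegrable_const.add (hgi.const_mul _))
        (intervalIntegrable_const.add (hqi.intervalIntegrable.div_const _)) fun x hx => ?_
      have h1 : ‖g₁ x - g₁ s‖ ≤ ε := by
        rw [← dist_eq_norm]
        refine (hg₁u ?_).le
        rw [Real.dist_eq, abs_lt]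
        constructor <;> linarith [hx.1, hx.2]
      have hqx : q x = ‖g x - g₁ x‖ ^ 2 := indicator_of_mem (hsub' hx) _
      have hqs : q s = ‖g s - g₁ s‖ ^ 2 := indicator_of_mem hsT _
      have h2 : ‖g x - g s‖ ≤ ‖g₁ x - g₁ s‖ + ‖g x - g₁ x‖ + ‖g s - g₁ s‖ := by
        have e : g x - g s = (g₁ x - g₁ s) + (g x - g₁ x) - (g s - g₁ s) := by abel
        rw [e]
        exact (norm_sub_le _ _).trans (add_le_add_left (norm_add_le _ _) _)
      have h3 : C * W s * ‖g x - g s‖ ≤ |C * W s| *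
          (‖g₁ x - g₁ s‖ + ‖g x - g₁ x‖ + ‖g s - g₁ s‖) :=
        mul_le_mul (le_abs_self _) h2 (norm_nonneg _) (abs_nonneg _)
      have k1 := mul_le_half_sq_add hε |C * W s| ‖g₁ x - g₁ s‖
      have k2 := mul_le_half_sq_add hε |C * W s| ‖g x - g₁ x‖
      have k3 := mul_le_half_sq_add hε |C * W s| ‖g s - g₁ s‖
      rw [sq_abs] at k1 k2 k3
      have k4 : ‖g₁ x - g₁ s‖ ^ 2 / (2 * ε) ≤ ε / 2 := by
        rw [div_le_iff₀ (by positivity)]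
        nlinarith [norm_nonneg (g₁ x - g₁ s)]
      simp only [B, hqx, hqs]
      linarith [mul_pow C (W s) 2]
    refine hb.trans (le_of_eq ?_)
    rw [intervalIntegral.integral_add intervalIntegrable_const
      (hqi.intervalIntegrable.div_const _), intervalIntegral.integral_const,
      intervalIntegral.integral_div, smul_eq_mul, sub_sub_cancel,
      intervalIntegral.integral_interval_sub_left hqi.intervalIntegrable hqi.intervalIntegrable]
  have hint : ∫ s in r..t, (y s - y (s - r)) ≤
      ∫ s in r..t, (r * B s + (Q s - Q (s - r)) / (2 * ε)) := by
    rw [intervalIntegral.integral_of_le hr1.2.le, intervalIntegral.integral_of_le hr1.2.le]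
    refine integral_mono_ae ?_ ?_ hpt
    · rw [← IntegrableOn, ← intervalIntegrable_iff_integrableOn_Ioc_of_le hr1.2.le]
      exact Continuous.intervalIntegrable (by fun_prop) _ _
    · rw [← IntegrableOn, ← intervalIntegrable_iff_integrableOn_Ioc_of_le hr1.2.le]
      exact (hBi.const_mul r).add hQi
  -- Telescoping the primitive `Q` supplies the factor `r`, which a pointwise bound on `Q s - Q (s -
  -- r)` would not.
  have hQb : ∫ s in r..t, (Q s - Q (s - r)) / (2 * ε) ≤ r * (ε / 2) := by
    rw [intervalIntegral.integral_div, integral_sub_comp_sub hQc, div_le_iff₀ (by positivity)]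
    have h1 : ∫ s in (t - r)..t, Q s ≤ ∫ s in (t - r)..t, ε ^ 2 :=
      intervalIntegral.integral_mono_on (by linarith) (hQc.intervalIntegrable _ _)
        intervalIntegrable_const fun s hs => hQle s (by linarith [hs.1])
    have h2 : 0 ≤ ∫ s in (0 : ℝ)..r, Q s :=
      intervalIntegral.integral_nonneg hr0.le fun s hs => hQ0 s hs.1
    rw [intervalIntegral.integral_const, sub_sub_cancel, smul_eq_mul] at h1
    linarith
  have hBb : ∫ s in r..t, B s ≤ K * (∫ s in (0 : ℝ)..t, y s) +
      3 / 2 * ε * C ^ 2 * (∫ s, W s ^ 2 ∂(timeMeasure T)) + t * (ε / 2) + ε / 2 := by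
    have e : ∫ s in r..t, B s = K * (∫ s in r..t, y s) +
        3 / 2 * ε * C ^ 2 * (∫ s in r..t, W s ^ 2) + (t - r) * (ε / 2) +
          (∫ s in r..t, q s) / (2 * ε) := by
      simp only [B]
      rw [intervalIntegral.integral_add ((hyi.add hWi').add intervalIntegrable_const) hqi',
        intervalIntegral.integral_add (hyi.add hWi') intervalIntegrable_const,
        intervalIntegral.integral_add hyi hWi', intervalIntegral.integral_const_mul,
        intervalIntegral.integral_const_mul, intervalIntegral.integral_const,
        intervalIntegral.integral_div, smul_eq_mul]
    rw [e]
    have h1 : ∫ s in r..t, y s ≤ ∫ s in (0 : ℝ)..t, y s :=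
      intervalIntegral.integral_mono_interval hr0.le hr1.2.le le_rfl
        (Eventually.of_forall hy0) (hy.intervalIntegrable _ _)
    have h2 : ∫ s in r..t, W s ^ 2 ≤ ∫ s, W s ^ 2 ∂(timeMeasure T) := by
      rw [intervalIntegral.integral_of_le hr1.2.le, ← integral_Ioc_eq_integral_Ioo]
      exact setIntegral_mono_set hWi (Eventually.of_forall fun s => sq_nonneg _)
        hsub.eventuallyLE
    have h3 : (∫ s in r..t, q s) / (2 * ε) ≤ ε / 2 := by
      rw [div_le_iff₀ (by positivity), intervalIntegral.integral_of_le hr1.2.le]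
      have := (setIntegral_le_integral (s := Ioc r t) hqi (Eventually.of_forall hq0)).trans hqle
      linarith
    have h4 : (t - r) * (ε / 2) ≤ t * (ε / 2) := by gcongr; linarith
    gcongr
  rw [intervalIntegral.integral_add (hBi.const_mul r) hQi,
    intervalIntegral.integral_const_mul] at hint
  have := mul_le_mul_of_nonneg_left hBb hr0.le
  refine hint.trans ((add_le_add this hQb).trans (le_of_eq ?_))
  rw [hD]
  ring

/-! ### Increment estimates for the solution. -/

theorem IsMR.inner_sub_eq_integral {V H : Type*} [NormedAddCommGroup V] [InnerProductSpace ℝ V]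
    [NormedAddCommGroup H] [InnerProductSpace ℝ H] {j : V →L[ℝ] H} {T : ℝ} {u : ℝ → H} {w : ℝ → V}
    {u' : ℝ → StrongDual ℝ V} (h : IsMR j T u w u') {r s : ℝ} (hr : 0 < r) (hrs : r < s)
    (hs : s < T) (v : V) : inner ℝ (u s - u r) (j v) = ∫ x in r..s, u' x v := by
  have hc : Continuous (embDual j) :=
    (((ContinuousLinearMap.compL ℝ V H ℝ).flip j).continuous).comp (innerSL ℝ).continuous
  have hi : Integrable u' (timeMeasure T) := h.memLp_deriv.integrable one_le_two
  have hFTC := HasWeakDeriv.integral_eq_sub (hc.comp_continuousOn h.continuousOn) hi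
    h.hasWeakDeriv hr hrs hs
  have hir : IntervalIntegrable u' volume r s :=
    (intervalIntegrable_iff_integrableOn_Ioo_of_le hrs.le).2
      (IntegrableOn.mono_set hi (Ioo_subset_Ioo hr.le hs.le))
  have := congrArg (fun l : StrongDual ℝ V => l v) hFTC
  rw [ContinuousLinearMap.intervalIntegral_apply hir] at this
  rw [this, inner_sub_left]
  rfl

section Lattice

variable {Ω : Type*} [MeasurableSpace Ω] {μ : Measure Ω}
  {V : Type*} [NormedAddCommGroup V] [InnerProductSpace ℝ V]

/-- A subsolution estimate for the negative part of the solution between the times `r` and `s`. -/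
theorem norm_negPart_sq_sub_le_integral {j : V →L[ℝ] Lp ℝ 2 μ} {T : ℝ} {u : ℝ → Lp ℝ 2 μ}
    {w : ℝ → V} {u' f : ℝ → StrongDual ℝ V} (h : IsMR j T u w u')
    (hf : MemLp f 2 (timeMeasure T)) (hf_pos : IsPositive j T f) {r s : ℝ} (hr : 0 < r)
    (hrs : r < s) (hs : s < T) {n : V} (hn : j n = (u s)⁻) {κ B : ℝ}
    (hκ : (f s - u' s) n ≤ κ) (hB : ‖n‖ ≤ B) :
    ‖(u s)⁻‖ ^ 2 - ‖(u r)⁻‖ ^ 2 ≤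
      ∫ x in r..s, (2 * κ + 2 * B * ‖(f x - u' x) - (f s - u' s)‖) := by
  have hsub : Ioo r s ⊆ Ioo 0 T := Ioo_subset_Ioo hr.le hs.le
  have hu'i : Integrable u' (timeMeasure T) := h.memLp_deriv.integrable one_le_two
  have hfi : Integrable f (timeMeasure T) := hf.integrable one_le_two
  refine (norm_negPart_sq_sub_le (u s) (u r)).trans ?_
  rw [← hn, h.inner_sub_eq_integral hr hrs hs, ← intervalIntegral.integral_const_mul,
    ← intervalIntegral.integral_neg, intervalIntegral.integral_of_le hrs.le,
    intervalIntegral.integral_of_le hrs.le, integral_Ioc_eq_integral_Ioo,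
    integral_Ioc_eq_integral_Ioo]
  refine integral_mono_ae ?_ ?_ ?_
  · exact (((hu'i.apply_continuousLinearMap n).const_mul 2).neg).mono_measure
      (Measure.restrict_mono_set _ hsub)
  · exact ((integrable_const _).add (((hfi.sub hu'i).sub (integrable_const _)).norm.const_mul
      _)).mono_measure (Measure.restrict_mono_set _ hsub)
  -- The exceptional null set in the positivity of `f` may depend on the test vector; this is
  -- harmless as `n` does not vary with `x`.
  · filter_upwards [ae_restrict_of_ae_restrict_of_subset hsub
      (hf_pos n (hn ▸ negPart_nonneg (u s)))] with x hx
    have h1 : ((f x - u' x) - (f s - u' s)) n ≤ B * ‖(f x - u' x) - (f s - u' s)‖ := by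
      rw [mul_comm]
      exact (Real.le_norm_self _).trans
        ((ContinuousLinearMap.le_opNorm _ n).trans (by gcongr))
    simp only [sub_apply] at h1 hκ ⊢
    linarith

end Lattice

end NonAutonomous

end

/-! ### Positivity of the solution. -/

theorem mainTheorem3 {Ω : Type*} [MeasurableSpace Ω] (μ : Measure Ω)
    {V : Type*} [NormedAddCommGroup V] [InnerProductSpace ℝ V] [CompleteSpace V]
    (j : V →L[ℝ] Lp ℝ 2 μ) (hj_inj : Function.Injective j) (hj_dense : DenseRange j)
    (T : ℝ) (hT : 0 < T)
    (𝔞 : ℝ → V →ₗ[ℝ] V →ₗ[ℝ] ℝ)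
    (h𝔞 : NonAutonomous.IsNonAutonomousClosedForm j T 𝔞)
    (hV : NonAutonomous.IsSublattice j)
    (h𝔞_neg : ∀ᵐ t ∂(NonAutonomous.timeMeasure T), ∀ v p n : V,
      j p = (j v)⁺ → j n = (j v)⁻ → 𝔞 t p n ≤ 0)
    (f : ℝ → StrongDual ℝ V) (hf : MemLp f 2 (NonAutonomous.timeMeasure T))
    (hf_pos : NonAutonomous.IsPositive j T f)
    (u₀ : Lp ℝ 2 μ) (hu₀ : 0 ≤ u₀)
    (u : ℝ → Lp ℝ 2 μ) (hu : NonAutonomous.IsSolution j T 𝔞 f u₀ u) :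
    ∀ t ∈ Icc 0 T, 0 ≤ u t := by
  obtain ⟨hu0, w, u', hMR, heq⟩ := hu
  obtain ⟨⟨M, hM⟩, ⟨c, α, hα, hc⟩, -⟩ := h𝔞
  let U : ℝ → Lp ℝ 2 μ := IccExtend hT.le ((Icc 0 T).domRestrict u)
  have hU : Continuous U := hMR.continuousOn.domRestrict.Icc_extend'
  have hUu : ∀ t ∈ Icc 0 T, U t = u t := fun t ht => IccExtend_of_mem hT.le _ ht
  have hy : Continuous fun s => ‖(U s)⁻‖ ^ 2 :=
    (NonAutonomous.continuous_negPart.comp hU).norm.pow 2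
  have hle := fun t (ht : t ∈ Ioc 0 T) =>
    NonAutonomous.le_add_mul_integral_of_forall_sub_le (K := 2 * |c|)
      (C := 2 * ((M + |c| * ‖j‖ ^ 2) / α)) (T := T) hy (fun s => by positivity) (by positivity)
      hMR.memLp.norm (hf.sub hMR.memLp_deriv) (by
        filter_upwards [h𝔞_neg, heq, hMR.ae_eq, ae_restrict_mem measurableSet_Ioo]
          with s hneg hs hws hsT r hr
        have hsI := Ioo_subset_Icc_self hsT
        obtain ⟨p, hp⟩ := hV (w s)
        obtain ⟨n, hn⟩ := hV (-w s)
        rw [map_neg, posPart_neg] at hn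
        obtain ⟨hB, hκ⟩ := NonAutonomous.norm_le_of_negPart hj_inj hα (hM s hsI) (hc s hsI) hneg
          hp hn
        rw [hUu s hsI, hUu r ⟨hr.1.le, (hr.2.trans hsT.2).le⟩]
        -- The equation is used only here, at the single time `s`; other times `x` enter through `g
        -- x - g s`.
        have hfs : (f s - u' s) n = 𝔞 s (w s) n := by
          rw [sub_apply, ← hs n, add_sub_cancel_left]
        rw [hws] at hn hκ
        simpa only [mul_assoc, Pi.sub_apply] using
          NonAutonomous.norm_negPart_sq_sub_le_integral hMR hf hf_pos hr.1 hr.2 hsT.2 hn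
            (hfs.trans_le hκ) hB) ht
  have h0 : ‖(U 0)⁻‖ ^ 2 = 0 := by
    rw [hUu 0 ⟨le_rfl, hT.le⟩, hu0, negPart_eq_zero.2 hu₀, norm_zero, zero_pow two_ne_zero]
  simp only [h0, zero_add] at hle
  intro t ht
  rcases ht.1.eq_or_lt with rfl | ht0
  · exact hu0 ▸ hu₀
  · have := NonAutonomous.nonpos_of_le_mul_integral hy (by positivity) hle t ⟨ht0, ht.2⟩
    rw [hUu t ht] at this
    exact negPart_eq_zero.1 (norm_eq_zero.1 (pow_eq_zero_iff two_ne_zero |>.1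
      (this.antisymm (sq_nonneg _))))
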